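/- Let $\Sigma$ be a finite set, let $R$ be a reflexive and symmetric relation on $\Sigma$, and let $\mathcal M_\Sigma=\langle \Sigma \mid ab=ba \text{ for } (a,b)\notin R\rangle$ be the trace monoid; $|x|$ is the length of $x\in\mathcal M_\Sigma$, and for $S\subseteq\Sigma$, $\mathcal M_S$ is the submonoid generated by $S$. For $x\in\mathcal M_\Sigma$, $\max(x)\subseteq\Sigma$ is the set of labels of the maximal elements of the heap of $x$: for any word $w_1\cdots w_n$ representing $x$, this heap is $\{1,\dots,n\}$, with $i$ labelled by $w_i$, ordered by the reflexive transitive closure of the relations $i\le j$ with $(w_i,w_j)\in R$. For $S\subseteq\Sigma$ let $\mu_S(X)=\sum_{\gamma}(-1)^{|\gamma|}X^{|\gamma|}$, where $\gamma$ ranges over the subsets of $S$ whose distinct elements are pairwise not $R$-related, and let $p_\Sigma\in(0,\infty]$ be the smallest modulus of a complex root of $\mu_\Sigma$ ($p_\Sigma=\infty$ if $\Sigma=\emptyset$). Put $\mathrm{Lk}(a)=\{b\in\Sigma : (a,b)\in R\}$. Let $p\in(0,p_\Sigma)$. For $S\subseteq\Sigma$ let $B_{S,p}$ be the measure on $\mathcal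 M_S$ with $B_{S,p}(\{x\})=\mu_S(p)\,p^{|x|}$. Consider the following recursive random algorithm, whose input is a pair $(S,T)$ of subsets of $\Sigma$ and in which all the values $\mu_X(p)$, $X\subseteq\Sigma$, are precomputed. 1. If $S\cap T=\emptyset$, return $1$. 2. Otherwise choose (arbitrarily) $a\in S\cap T$, set $r=1-\mu_S(p)/\mu_{S\setminus\{a\}}(p)$, draw an integer $K\ge 0$ with the geometric law $\mathbb P(K=k)=(1-r)r^k$, and set $\xi=1$. 3. For $i=0,\dots,K-1$: let $v$ be the output of the algorithm on input $(S\setminus\{a\},\mathrm{Lk}(a))$, and replace $\xi$ by $\xi\cdot v\cdot a$. 4. Let $u$ be the output of the algorithm on input $(S\setminus\{a\},T)$; return $\xi\cdot u$. Then, for all $S\subseteq\Sigma$, $\mu_S(p)>0$ and $B_{S,p}$ is a probability distribution, and the algorithm is well defined, with $r\in(0,1)$ at every call. Whatever choices of $a$ are made (they may depend on the values of the program's variables): - on input $(\Sigma,\Sigma)$ the output $\xi\in\mathcal M_\Sigma$ is distributed according to $B_{\Sigma,p}$; - more generally, on input $(S,T)$ the output $\xi\in\mathcal M_S$ is distributed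 according to $B_{S,p}$ conditioned on $\{\max(\xi)\subseteq T\}$. Assume moreover that every elementary operation (function call, test, choice of an element, evaluation of $r$, variable assignment, multiplication in $\mathcal M_\Sigma$, loop control, return) takes a constant number of steps, and that the routine that draws a random integer takes, besides the cost of its call, at most $k$ steps when it outputs $k$. Then there is a constant $C$, depending only on these constants, such that every execution on input $(\Sigma,\Sigma)$, with $\Sigma\neq\emptyset$, that outputs $\xi$ takes at most $C\,|\Sigma|\,(|\xi|+1)$ steps, and every execution on input $(S,T)$ that outputs $\xi$ takes at most $C\,(|S|+1)(|\xi|+1)$ steps. -/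

import Mathlib

universe u

noncomputable section

namespace TraceSampling

open MeasureTheory Polynomial
open scoped ENNReal

section Traces

variable {σ : Type u}

/-- The defining relations `ab = ba` for `(a, b) ∉ R`. -/
inductive CommRel (R : σ → σ → Prop) : FreeMonoid σ → FreeMonoid σ → Prop
  | swap (a b : σ) (h : ¬ R a b) :
      CommRel R (FreeMonoid.of a * FreeMonoid.of b) (FreeMonoid.of b * FreeMonoid.of a)

/-- The trace monoid `⟨σ | ab = ba for (a, b) ∉ R⟩`. -/
abbrev TraceMonoid (R : σ → σ → Prop) : Type u := PresentedMonoid (CommRel R)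

/-- The trace monoid is a discrete (countable) space. -/
instance (R : σ → σ → Prop) : MeasurableSpace (TraceMonoid R) := ⊤

variable (R : σ → σ → Prop)

/-- The generator of the trace monoid given by a letter. -/
def letter (a : σ) : TraceMonoid R := PresentedMonoid.of (CommRel R) a

/-- The trace (equivalence class) of a word. -/
def ofWord (w : List σ) : TraceMonoid R := (w.map (letter R)).prod

/-- The length of a trace, as a monoid homomorphism. -/
def lengthHom : TraceMonoid R →* Multiplicative ℕ :=
  PresentedMonoid.lift (fun _ : σ => Multiplicative.ofAdd 1) (by
    rintro _ _ ⟨a, b, h⟩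
    rfl)

variable {R} in
/-- The length `|x|` of a trace `x`: the common length of the words in its class. -/
def length (x : TraceMonoid R) : ℕ := (lengthHom R x).toAdd

/-- `M_S`: the submonoid generated by the letters in `S`. -/
def subTraces (S : Finset σ) : Submonoid (TraceMonoid R) :=
  Submonoid.closure (letter R '' (S : Set σ))

/-- The order of the heap of a word `w`. The elements of the heap are the positions of `w`, position
`i` being labelled by `w.get i`, and the order is the transitive closure of the relations `i ≤ j`
between positions with `R`-related labels. Words of the same trace have isomorphic heaps. -/
def heapLE (w : List σ) : Fin w.length → Fin w.length → Prop :=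
  Relation.ReflTransGen fun i j => i ≤ j ∧ R (w.get i) (w.get j)

variable {R} in
/-- `max(x)`: the labels of the maximal elements of the heap of the trace `x`. -/
def maxLabels (x : TraceMonoid R) : Set σ :=
  {a | ∃ w : List σ, ofWord R w = x ∧
    ∃ i : Fin w.length, w.get i = a ∧ ∀ j, heapLE R w i j → j = i}

end Traces

section Mobius

variable {σ : Type u} [DecidableEq σ] (R : σ → σ → Prop) [DecidableRel R]

/-- The Möbius polynomial `μ_S`. A clique `a₁ ⋯ a_k` (a product of distinct, pairwise not
`R`-related letters of `S`) is encoded by its set of letters. -/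
def mobius (S : Finset σ) : ℝ[X] :=
  ∑ γ ∈ S.powerset with ∀ a ∈ γ, ∀ b ∈ γ, a ≠ b → ¬ R a b, (-1) ^ γ.card * X ^ γ.card

/-- `p_S`: the smallest modulus of a complex root of `μ_S`; it is `∞` for the empty alphabet, where
`μ_S = 1` has no root. -/
def smallestRoot (S : Finset σ) : ℝ≥0∞ :=
  ⨅ z ∈ {z : ℂ | aeval z (mobius R S) = 0}, ‖z‖ₑ

/-- The multiplicative probability `B_{S,p}`: mass `μ_S(p) p^|x|` at each `x ∈ M_S`. -/
def multProb (S : Finset σ) (p : ℝ) : Measure (TraceMonoid R) :=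
  Measure.sum fun x : subTraces R S =>
    ENNReal.ofReal ((mobius R S).eval p * p ^ length (x : TraceMonoid R)) •
      Measure.dirac (x : TraceMonoid R)

/-- The link `Lk(a)`: all letters `b` with `(a, b) ∈ R`. -/
def link [Fintype σ] (a : σ) : Finset σ := Finset.univ.filter fun b => R a b

/-- The parameter `r = 1 - μ_S(p) / μ_{S∖{a}}(p)`. -/
def geomParam (S : Finset σ) (p : ℝ) (a : σ) : ℝ :=
  1 - (mobius R S).eval p / (mobius R (S \ {a})).eval p

end Mobius

/-- The geometric law with `P(K = k) = (1 - r) r^k`. The value for `r ∉ [0, 1)` is a placeholder. -/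
def geometric (r : ℝ) : PMF ℕ :=
  if h : 0 ≤ r ∧ r < 1 then
    ⟨fun k => ENNReal.ofReal ((1 - r) * r ^ k), by
      have hs : HasSum (fun k : ℕ => (1 - r) * r ^ k) 1 := by
        have h1 := (hasSum_geometric_of_lt_one h.1 h.2).mul_left (1 - r)
        rwa [mul_inv_cancel₀ (by linarith [h.2])] at h1
      have hn : ∀ k : ℕ, 0 ≤ (1 - r) * r ^ k := fun k =>
        mul_nonneg (by linarith [h.2]) (pow_nonneg h.1 k)
      have ht := ENNReal.ofReal_tsum_of_nonneg hn hs.summable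
      rw [hs.tsum_eq, ENNReal.ofReal_one] at ht
      rw [ht]
      exact ENNReal.summable.hasSum⟩
  else PMF.pure 0

section Timed

universe v w

/-- The joint law of the result and of the number of steps of a terminating random computation. -/
abbrev Timed (α : Type v) : Type v := PMF (α × ℕ)

/-- Return a value, without any step. -/
def Timed.ret {α : Type v} (a : α) : Timed α := PMF.pure (a, 0)

/-- Spend `n` steps, then run `m`. -/
def Timed.tick {α : Type v} (n : ℕ) (m : Timed α) : Timed α := m.map fun x => (x.1, n + x.2)

/-- Run `m`, then `f` on its result, with fresh randomness; the steps add up. -/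
def Timed.bind {α : Type v} {β : Type w} (m : Timed α) (f : α → Timed β) : Timed β :=
  PMF.bind m fun x => (f x.1).map fun y => (y.1, x.2 + y.2)

/-- `for i = 0 to K - 1 do s ← body i s`, starting with `s = init`. -/
def Timed.forLoop {α : Type v} (body : ℕ → α → Timed α) (init : α) : ℕ → Timed α
  | 0 => Timed.ret init
  | K + 1 => Timed.bind (Timed.forLoop body init K) (body K)

end Timed

/-- The (constant) numbers of steps of the elementary operations: a function call, the test
`S ∩ T = ∅`, the choice of an element of `S ∩ T`, the evaluation of `r` from precomputed values,
a variable assignment, a multiplication in the monoid, the loop control, and a return. -/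
structure OpCosts where
  call : ℕ
  test : ℕ
  choose : ℕ
  arith : ℕ
  assign : ℕ
  mul : ℕ
  loop : ℕ
  ret : ℕ

section Algorithm

variable {σ : Type u} [Fintype σ] [DecidableEq σ] (R : σ → σ → Prop) [DecidableRel R]

/-- A resolution of all the instructions "choose `a ∈ S ∩ T`" in an execution on input `(S, T)`. The
choices are arbitrary, and those made inside a recursive call may depend on the values of the
variables at the time of the call: on `K`, `i` and `ξ` in the `i`-th pass of the loop, and on
`K` and `ξ` in the last call. -/
inductive Choices : Finset σ → Finset σ → Type u
  | halt {S T : Finset σ} (h : S ∩ T = ∅) : Choices S T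
  | step {S T : Finset σ} (a : σ) (ha : a ∈ S ∩ T)
      (V : ℕ → ℕ → TraceMonoid R → Choices (S \ {a}) (link R a))
      (U : ℕ → TraceMonoid R → Choices (S \ {a}) T) : Choices S T

variable {R}

/-- The recursive sampling algorithm on input `(S, T)`, with parameter `p`; `draw k` is the number of
steps of the routine for random integers when it outputs `k`. -/
def run (c : OpCosts) (draw : ℕ → ℕ) (p : ℝ) :
    {S T : Finset σ} → Choices R S T → Timed (TraceMonoid R)
  | _, _, .halt _ =>
      -- return the unit
      Timed.tick (c.call + c.test + c.ret) (Timed.ret 1)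
  | S, _, .step a _ V U =>
      -- choose `a`; `r ← 1 - μ_S(p) / μ_{S∖{a}}(p)`
      Timed.tick (c.call + c.test + c.choose + c.arith + c.assign) <|
      -- `K ← G(r)`
      Timed.bind ((geometric (geomParam R S p a)).map
          fun K => (K, c.call + draw K + c.assign)) fun K =>
      -- `ξ ← 1`; for `i = 0` to `K - 1`: `v ←` output on `(S∖{a}, Lk(a))`; `ξ ← ξ · v · a`
      Timed.tick (c.assign + c.loop) <|
      Timed.bind (Timed.forLoop (fun i ξ =>
          Timed.bind (run c draw p (V K i ξ)) fun v =>
            Timed.tick (c.assign + 2 * c.mul + c.assign + c.loop)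
              (Timed.ret (ξ * v * letter R a))) 1 K) fun ξ =>
      -- `u ←` output on `(S∖{a}, T)`; `ξ ← ξ · u`; return `ξ`
      Timed.bind (run c draw p (U K ξ)) fun u =>
        Timed.tick (c.assign + c.mul + c.assign + c.ret) (Timed.ret (ξ * u))

/-- The law of the output of the algorithm. -/
def outputLaw (c : OpCosts) (draw : ℕ → ℕ) (p : ℝ) {S T : Finset σ} (d : Choices R S T) :
    Measure (TraceMonoid R) :=
  ((run c draw p d).map Prod.fst).toMeasure

end Algorithm

end TraceSampling

end

/-!
Let `y` consist of the elements of the heap of a trace `x` lying below an occurrence of `a`. This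
gives a unique factorization `x = y * u` where `y` has no maximal label other than `a` and `u` does
not contain `a`; likewise `y = (v₁ * a) * ⋯ * (v_K * a)` uniquely, where `vᵢ` does not contain `a`
and `max(vᵢ) ⊆ Lk(a)`. The algorithm draws `K`, then the `vᵢ` and `u` independently. As lengths add
up along the factorization, its output is multiplicative: by induction, on input `(S, T)` each trace
`x` over `S` with `max(x) ⊆ T` has probability `μ_S(p) / μ_{S∖T}(p) * p^|x|`. The constants agree
because the recursion `μ_S = μ_{S∖{a}} - X μ_{S∖Lk(a)}` turns the parameter of the geometric law
into `r = p μ_{S∖Lk(a)}(p) / μ_{S∖{a}}(p)`.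

The number of passes of the loop is the number of occurrences of `a` in the output, so the cost of
the passes can be charged to the length of the output, and the depth of the recursion is at most
`|S|`.
-/

noncomputable section

namespace TraceSampling

open MeasureTheory Polynomial
open scoped ENNReal

section Traces

variable {σ : Type u} {R : σ → σ → Prop}

theorem letter_mul_letter_comm {a b : σ} (h : ¬ R a b) :
    letter R a * letter R b = letter R b * letter R a :=
  PresentedMonoid.mk_eq_mk_of_rel (CommRel.swap a b h)

@[elab_as_elim]
theorem trace_induction {P : TraceMonoid R → Prop} (one : P 1)
    (mul_letter : ∀ x a, P x → P (x * letter R a)) (x : TraceMonoid R) : P x :=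
  Submonoid.induction_of_closure_eq_top_right (PresentedMonoid.closure_range_of (CommRel R)) x one
    (by rintro x _ ⟨a, rfl⟩; exact mul_letter x a)

theorem eq_one_or_exists_eq_mul_letter (x : TraceMonoid R) :
    x = 1 ∨ ∃ y a, x = y * letter R a := by
  induction x using trace_induction with
  | one => exact .inl rfl
  | mul_letter x a _ => exact .inr ⟨x, a, rfl⟩

@[simp] theorem ofWord_singleton (a : σ) : ofWord R [a] = letter R a := by
  simp [ofWord]

theorem ofWord_append (w w' : List σ) : ofWord R (w ++ w') = ofWord R w * ofWord R w' := by
  simp [ofWord]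

theorem ofWord_surjective : Function.Surjective (ofWord R) := by
  intro x
  induction x using trace_induction with
  | one => exact ⟨[], rfl⟩
  | mul_letter x a ih =>
    obtain ⟨w, rfl⟩ := ih
    exact ⟨w ++ [a], by rw [ofWord_append, ofWord_singleton]⟩

instance [Countable σ] : Countable (TraceMonoid R) :=
  ofWord_surjective.countable

instance : DiscreteMeasurableSpace (TraceMonoid R) := ⟨fun _ => trivial⟩

@[simp] theorem length_one : length (1 : TraceMonoid R) = 0 := by simp [length]

@[simp] theorem length_mul (x y : TraceMonoid R) : length (x * y) = length x + length y := by
  simp [length]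

@[simp] theorem length_letter (a : σ) : length (letter R a) = 1 := rfl

section Count

variable [DecidableEq σ]

/-- The number of occurrences of the letter `a` in a trace, as a monoid homomorphism. -/
def countHom (R : σ → σ → Prop) (a : σ) : TraceMonoid R →* Multiplicative ℕ :=
  PresentedMonoid.lift (fun b : σ => Multiplicative.ofAdd (if b = a then 1 else 0)) (by
    rintro _ _ ⟨b, c, h⟩
    simp [mul_comm])

/-- The number of occurrences `|x|_a` of the letter `a` in the trace `x`. -/
def count (a : σ) (x : TraceMonoid R) : ℕ := (countHom R a x).toAdd

@[simp] theorem count_one (a : σ) : count a (1 : TraceMonoid R) = 0 := by simp [count]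

@[simp] theorem count_mul (a : σ) (x y : TraceMonoid R) :
    count a (x * y) = count a x + count a y := by
  simp [count]

@[simp] theorem count_letter (a b : σ) : count a (letter R b) = if b = a then 1 else 0 := rfl

theorem ne_of_count_mul_letter_eq_zero {a b : σ} {x : TraceMonoid R}
    (h : count a (x * letter R b) = 0) : b ≠ a := by
  rintro rfl
  simp at h

theorem mem_subTraces_iff {S : Finset σ} {x : TraceMonoid R} :
    x ∈ subTraces R S ↔ ∀ a ∉ S, count a x = 0 := by
  constructor
  · intro hx a ha
    induction hx using Submonoid.closure_induction with
    | mem x hx =>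
      obtain ⟨b, hb, rfl⟩ := hx
      exact if_neg (ne_of_mem_of_not_mem hb ha)
    | one => exact count_one a
    | mul x y _ _ hx hy => rw [count_mul, hx, hy]
  · intro h
    induction x using trace_induction with
    | one => exact one_mem _
    | mul_letter x b ih =>
      have hx : ∀ a ∉ S, count a x = 0 := fun a ha =>
        (Nat.add_eq_zero_iff.1 ((count_mul a x _).symm.trans (h a ha))).1
      have hb : b ∈ S := by
        by_contra hb
        exact ne_of_count_mul_letter_eq_zero (h b hb) rfl
      exact mul_mem (ih hx) (Submonoid.subset_closure ⟨b, hb, rfl⟩)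

theorem mem_subTraces_sdiff_singleton_iff {S : Finset σ} {a : σ} {x : TraceMonoid R} :
    x ∈ subTraces R (S \ {a}) ↔ x ∈ subTraces R S ∧ count a x = 0 := by
  simp only [mem_subTraces_iff, Finset.mem_sdiff, Finset.mem_singleton, not_and_or, not_not,
    or_imp, forall_and, forall_eq]

end Count

theorem mul_mem_subTraces_iff {S : Finset σ} {x y : TraceMonoid R} :
    x * y ∈ subTraces R S ↔ x ∈ subTraces R S ∧ y ∈ subTraces R S := by
  classical
  simp only [mem_subTraces_iff, count_mul, Nat.add_eq_zero_iff, forall_and]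

theorem letter_mem_subTraces_iff {S : Finset σ} {a : σ} :
    letter R a ∈ subTraces R S ↔ a ∈ S := by
  classical
  simp [mem_subTraces_iff, not_imp_not]

section RightQuotient

variable [DecidableEq σ] [DecidableRel R]

/-- The effect of appending the letter `c` to a trace: `s.1` is the trace and `s.2` is its right
quotient by the letter `b`, if there is one. -/
def quotStep (R : σ → σ → Prop) [DecidableRel R] (b c : σ)
    (s : TraceMonoid R × Option (TraceMonoid R)) : TraceMonoid R × Option (TraceMonoid R) :=
  (s.1 * letter R c,
    if c = b then some s.1 else if R b c then none else s.2.map (· * letter R c))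

variable [Std.Symm R]

theorem quotStep_comm {c d : σ} (h : ¬ R c d) (b : σ)
    (s : TraceMonoid R × Option (TraceMonoid R)) :
    quotStep R b d (quotStep R b c s) = quotStep R b c (quotStep R b d s) := by
  obtain rfl | hne := eq_or_ne c d
  · rfl
  have hcd := letter_mul_letter_comm h
  have h' : ¬ R d c := mt symm h
  ext1
  · simp [quotStep, mul_assoc, hcd]
  · by_cases hc : c = b
    · subst hc
      simp [quotStep, hne.symm, h]
    by_cases hd : d = b
    · subst hd
      simp [quotStep, hne, h']
    by_cases hbc : R b c <;> by_cases hbd : R b d <;>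
      simp [quotStep, hc, hd, hbc, hbd, mul_assoc, hcd, Function.comp_def]

/-- The right action of the traces generated by `quotStep`; the opposite monoid is there because
words are read from left to right. -/
def quotHom (R : σ → σ → Prop) [DecidableRel R] [Std.Symm R] (b : σ) :
    TraceMonoid R →* (Function.End (TraceMonoid R × Option (TraceMonoid R)))ᵐᵒᵖ :=
  PresentedMonoid.lift (M := (Function.End (TraceMonoid R × Option (TraceMonoid R)))ᵐᵒᵖ)
    (fun c : σ => MulOpposite.op (quotStep R b c)) (by
    rintro _ _ ⟨c, d, h⟩
    simp only [map_mul, FreeMonoid.lift_eval_of]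
    exact MulOpposite.unop_injective (funext (quotStep_comm h b)))

/-- The right quotient of the trace `x` by the letter `b`, that is, the trace `y` such that
`x = y * b`, if it exists. -/
def rightQuotient (b : σ) (x : TraceMonoid R) : Option (TraceMonoid R) :=
  ((quotHom R b x).unop (1, none)).2

theorem quotHom_mul_letter (b c : σ) (x : TraceMonoid R)
    (s : TraceMonoid R × Option (TraceMonoid R)) :
    (quotHom R b (x * letter R c)).unop s = quotStep R b c ((quotHom R b x).unop s) := by
  rw [map_mul, MulOpposite.unop_mul]
  rfl

theorem quotHom_one_fst (b : σ) (x : TraceMonoid R) :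
    ((quotHom R b x).unop (1, none)).1 = x := by
  induction x using trace_induction with
  | one => rw [map_one]; rfl
  | mul_letter x c ih => rw [quotHom_mul_letter, quotStep, ih]

@[simp] theorem rightQuotient_one (b : σ) : rightQuotient b (1 : TraceMonoid R) = none := by
  rw [rightQuotient, map_one]
  rfl

theorem rightQuotient_mul_letter (b c : σ) (x : TraceMonoid R) :
    rightQuotient b (x * letter R c) =
      if c = b then some x
      else if R b c then none else (rightQuotient b x).map (· * letter R c) := by
  rw [rightQuotient, quotHom_mul_letter, quotStep, quotHom_one_fst]
  rfl

theorem eq_mul_letter_of_rightQuotient_eq_some {b : σ} {x y : TraceMonoid R}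
    (h : rightQuotient b x = some y) : x = y * letter R b := by
  induction x using trace_induction generalizing y with
  | one => simp at h
  | mul_letter x c ih =>
    rw [rightQuotient_mul_letter] at h
    split_ifs at h with hcb hR
    · rw [hcb, Option.some.inj h]
    · obtain ⟨z, hz, rfl⟩ := Option.map_eq_some_iff.1 h
      rw [ih hz, mul_assoc, mul_assoc, letter_mul_letter_comm hR]

end RightQuotient

section Cancellation

variable [Std.Symm R]

theorem mul_letter_eq_mul_letter_iff {a b : σ} {x y : TraceMonoid R} :
    x * letter R a = y * letter R b ↔
      (a = b ∧ x = y) ∨ (a ≠ b ∧ ¬ R b a ∧ ∃ z, x = z * letter R b ∧ y = z * letter R a) := by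
  classical
  constructor
  · intro h
    have hquot := congrArg (rightQuotient b) h
    rw [rightQuotient_mul_letter, rightQuotient_mul_letter, if_pos rfl] at hquot
    split_ifs at hquot with hab hR
    · exact .inl ⟨hab, Option.some.inj hquot⟩
    · obtain ⟨z, hz, rfl⟩ := Option.map_eq_some_iff.1 hquot
      exact .inr ⟨hab, hR, z, eq_mul_letter_of_rightQuotient_eq_some hz, rfl⟩
  · rintro (⟨rfl, rfl⟩ | ⟨-, hR, z, rfl, rfl⟩)
    · rfl
    · rw [mul_assoc, mul_assoc, letter_mul_letter_comm hR]

theorem mul_letter_right_cancel {a : σ} {x y : TraceMonoid R}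
    (h : x * letter R a = y * letter R a) : x = y := by
  obtain ⟨-, hxy⟩ | ⟨hne, -⟩ := mul_letter_eq_mul_letter_iff.1 h
  · exact hxy
  · exact absurd rfl hne

end Cancellation

section MaxLabels

theorem letter_mul_ofWord_comm {a : σ} {w : List σ} (h : ∀ b ∈ w, ¬ R a b) :
    letter R a * ofWord R w = ofWord R w * letter R a :=
  Commute.list_prod_right _ _ <| List.forall_mem_map.2 fun b hb => letter_mul_letter_comm (h b hb)

theorem ofWord_eq_mul_letter {w : List σ} {i : Fin w.length}
    (h : ∀ j, i < j → ¬ R (w.get i) (w.get j)) :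
    ofWord R w = ofWord R (w.take i) * ofWord R (w.drop (i + 1)) * letter R (w.get i) := by
  have hcomm : ∀ b ∈ w.drop (i + 1), ¬ R (w.get i) b := by
    intro b hb
    obtain ⟨j, hj, rfl⟩ := List.mem_iff_getElem.1 hb
    rw [List.length_drop] at hj
    rw [List.getElem_drop]
    exact h ⟨i + 1 + j, by omega⟩ (Fin.lt_def.2 (by simp only; omega))
  calc ofWord R w = ofWord R (w.take i ++ [w.get i] ++ w.drop (i + 1)) := by simp
    _ = _ := by rw [ofWord_append, ofWord_append, ofWord_singleton, mul_assoc, mul_assoc,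
      letter_mul_ofWord_comm hcomm]

theorem le_of_heapLE {w : List σ} {i j : Fin w.length} (h : heapLE R w i j) : i ≤ j := by
  induction h with
  | refl => exact le_rfl
  | tail _ hstep ih => exact ih.trans hstep.1

theorem mem_maxLabels_iff {a : σ} {x : TraceMonoid R} :
    a ∈ maxLabels x ↔ ∃ y, x = y * letter R a := by
  constructor
  · rintro ⟨w, rfl, i, rfl, hi⟩
    exact ⟨_, ofWord_eq_mul_letter fun j hij hR =>
      hij.ne' (hi j (.single ⟨hij.le, hR⟩))⟩
  · rintro ⟨y, rfl⟩
    obtain ⟨w, rfl⟩ := ofWord_surjective y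
    refine ⟨w ++ [a], by rw [ofWord_append, ofWord_singleton], ⟨w.length, by simp⟩, by simp,
      fun j hj => (Fin.le_def.2 ?_).antisymm (le_of_heapLE hj)⟩
    have hlt : (j : ℕ) < w.length + 1 := by simpa using j.2
    exact Nat.le_of_lt_succ hlt

theorem maxLabels_one : maxLabels (1 : TraceMonoid R) = ∅ := by
  refine Set.eq_empty_iff_forall_notMem.2 fun a ha => ?_
  obtain ⟨y, hy⟩ := mem_maxLabels_iff.1 ha
  simpa using congrArg length hy

theorem mem_maxLabels_mul_letter_self (x : TraceMonoid R) (a : σ) :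
    a ∈ maxLabels (x * letter R a) :=
  mem_maxLabels_iff.2 ⟨x, rfl⟩

theorem maxLabels_subset_maxLabels_mul (x y : TraceMonoid R) :
    maxLabels y ⊆ maxLabels (x * y) := by
  intro a ha
  obtain ⟨z, rfl⟩ := mem_maxLabels_iff.1 ha
  rw [← mul_assoc]
  exact mem_maxLabels_mul_letter_self _ a

theorem maxLabels_subset_of_mem_subTraces {S : Finset σ} {x : TraceMonoid R}
    (hx : x ∈ subTraces R S) : maxLabels x ⊆ S := by
  classical
  intro a ha
  obtain ⟨y, rfl⟩ := mem_maxLabels_iff.1 ha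
  exact letter_mem_subTraces_iff.1 (mul_mem_subTraces_iff.1 hx).2

theorem eq_one_of_maxLabels_eq_empty {x : TraceMonoid R} (hx : maxLabels x = ∅) : x = 1 := by
  obtain rfl | ⟨y, a, rfl⟩ := eq_one_or_exists_eq_mul_letter x
  · rfl
  · exact (Set.eq_empty_iff_forall_notMem.1 hx a (mem_maxLabels_mul_letter_self y a)).elim

theorem exists_eq_mul_maxLabels_subset [DecidableEq σ] (A : Set σ) (x : TraceMonoid R) :
    ∃ y v, x = y * v ∧ maxLabels y ⊆ A ∧ ∀ a ∈ A, count a v = 0 := by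
  induction h : length x using Nat.strong_induction_on generalizing x with
  | _ n ih =>
    by_cases hx : maxLabels x ⊆ A
    · exact ⟨x, 1, (mul_one x).symm, hx, fun a _ => count_one a⟩
    · obtain ⟨b, hb, hbA⟩ := Set.not_subset.1 hx
      obtain ⟨z, rfl⟩ := mem_maxLabels_iff.1 hb
      obtain ⟨y, v, rfl, hy, hv⟩ := ih (length z) (by simp [← h]) z rfl
      refine ⟨y, v * letter R b, mul_assoc _ _ _, hy, fun a ha => ?_⟩
      rw [count_mul, hv a ha, count_letter, if_neg (ne_of_mem_of_not_mem ha hbA).symm]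

variable [Std.Symm R]

theorem mem_maxLabels_mul_letter_iff {x : TraceMonoid R} {a b : σ} :
    b ∈ maxLabels (x * letter R a) ↔ b = a ∨ (b ∈ maxLabels x ∧ ¬ R b a) := by
  constructor
  · intro h
    obtain ⟨y, hy⟩ := mem_maxLabels_iff.1 h
    obtain ⟨hab, -⟩ | ⟨-, hR, z, hz, -⟩ := mul_letter_eq_mul_letter_iff.1 hy
    · exact .inl hab.symm
    · exact .inr ⟨mem_maxLabels_iff.2 ⟨z, hz⟩, hR⟩
  · rintro (rfl | ⟨hb, hR⟩)
    · exact mem_maxLabels_mul_letter_self x b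
    · obtain ⟨y, rfl⟩ := mem_maxLabels_iff.1 hb
      rw [mul_assoc, letter_mul_letter_comm hR, ← mul_assoc]
      exact mem_maxLabels_mul_letter_self _ b

theorem maxLabels_mul_subset (x y : TraceMonoid R) :
    maxLabels (x * y) ⊆ maxLabels x ∪ maxLabels y := by
  induction y using trace_induction with
  | one => simp
  | mul_letter y a ih =>
    intro b hb
    rw [← mul_assoc, mem_maxLabels_mul_letter_iff] at hb
    rw [Set.mem_union, mem_maxLabels_mul_letter_iff]
    obtain rfl | ⟨hb, hR⟩ := hb
    · exact .inr (.inl rfl)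
    · exact (ih hb).imp_right fun hb => .inr ⟨hb, hR⟩

theorem injOn_mul_maxLabels_subset [DecidableEq σ] (A : Set σ) :
    Set.InjOn (fun z : TraceMonoid R × TraceMonoid R => z.1 * z.2)
      ({y | maxLabels y ⊆ A} ×ˢ {v | ∀ a ∈ A, count a v = 0}) := by
  rintro ⟨y, v⟩ ⟨hy, hv⟩ ⟨y', v'⟩ ⟨hy', hv'⟩ h
  simp only [Set.mem_ofPred_eq] at hy hv hy' hv' h
  have last_notMem {z : TraceMonoid R} {b : σ} (hz : ∀ a ∈ A, count a (z * letter R b) = 0) :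
      b ∉ A := fun hb => ne_of_count_mul_letter_eq_zero (hz b hb) rfl
  induction v using trace_induction generalizing v' with
  | one =>
    obtain rfl | ⟨z, b, rfl⟩ := eq_one_or_exists_eq_mul_letter v'
    · simpa using h
    · have hb : b ∈ maxLabels y := by
        rw [← mul_one y, h, ← mul_assoc]
        exact mem_maxLabels_mul_letter_self _ b
      exact absurd (hy hb) (last_notMem hv')
  | mul_letter v b ih =>
    have hb : b ∈ maxLabels (y' * v') := by
      rw [← h, ← mul_assoc]
      exact mem_maxLabels_mul_letter_self _ b
    have hbv' : b ∈ maxLabels v' :=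
      (maxLabels_mul_subset y' v' hb).resolve_left fun hb => last_notMem hv (hy' hb)
    obtain ⟨z, rfl⟩ := mem_maxLabels_iff.1 hbv'
    rw [← mul_assoc, ← mul_assoc] at h
    simp only [count_mul, Nat.add_eq_zero_iff] at hv hv'
    have hyv := ih (fun a ha => (hv a ha).1) z (fun a ha => (hv' a ha).1)
      (mul_letter_right_cancel h)
    rw [Prod.mk.injEq] at hyv ⊢
    exact ⟨hyv.1, by rw [hyv.2]⟩

end MaxLabels

end Traces

theorem exists_forall_nonneg_and_eq_zero {ι : Type*} [Finite ι] {f : ι → ℝ → ℝ} {a b : ℝ}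
    (hab : a ≤ b) (hf : ∀ i, ContinuousOn (f i) (Set.Icc a b)) (ha : ∀ i, 0 ≤ f i a) {j : ι}
    (hj : f j b ≤ 0) : ∃ t ∈ Set.Icc a b, (∀ i, 0 ≤ f i t) ∧ ∃ i, f i t = 0 := by
  have := Fintype.ofFinite ι
  have hne : (Finset.univ : Finset ι).Nonempty := ⟨j, Finset.mem_univ j⟩
  let g : ℝ → ℝ := fun t => Finset.univ.inf' hne fun i => f i t
  have hg : ContinuousOn g (Set.Icc a b) := ContinuousOn.finset_inf'_apply hne fun i _ => hf i
  have hga : 0 ≤ g a := Finset.le_inf' _ _ fun i _ => ha i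
  have hgb : g b ≤ 0 := (Finset.inf'_le _ (Finset.mem_univ j)).trans hj
  obtain ⟨t, ht, hgt⟩ := intermediate_value_Icc' hab hg ⟨hgb, hga⟩
  obtain ⟨i, -, hi⟩ := Finset.exists_mem_eq_inf' hne fun i => f i t
  exact ⟨t, ht, fun i => hgt.ge.trans (Finset.inf'_le _ (Finset.mem_univ i)), i, hi ▸ hgt⟩

section Mobius

variable {σ : Type u} [DecidableEq σ] {R : σ → σ → Prop} [DecidableRel R]

theorem mobius_eval_zero (S : Finset σ) : (mobius R S).eval 0 = 1 := by
  rw [mobius, eval_finsetSum, Finset.sum_eq_single ∅]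
  · simp
  · intro γ _ hγ
    simp [Finset.card_ne_zero.2 (Finset.nonempty_iff_ne_empty.2 hγ)]
  · simp

theorem mobius_empty : mobius R ∅ = 1 := by
  simp [mobius, Finset.filter_singleton]

theorem mobius_eval_ne_zero_of_lt_smallestRoot {S : Finset σ} {t : ℝ} (h0 : 0 ≤ t)
    (ht : ENNReal.ofReal t < smallestRoot R S) : (mobius R S).eval t ≠ 0 := by
  intro hroot
  have hroot' : aeval (t : ℂ) (mobius R S) = 0 := by
    rw [← Complex.coe_algebraMap, aeval_algebraMap_apply_eq_algebraMap_eval, hroot, map_zero]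
  have hle : smallestRoot R S ≤ ‖(t : ℂ)‖ₑ := iInf₂_le (t : ℂ) hroot'
  rw [← ofReal_norm, Complex.norm_of_nonneg h0] at hle
  exact hle.not_gt ht

omit [DecidableEq σ] in
theorem mem_link [Fintype σ] {a b : σ} : b ∈ link R a ↔ R a b := by
  simp [link]

theorem sdiff_singleton_sdiff {α : Type*} [DecidableEq α] (S : Finset α) {T : Finset α} {a : α}
    (ha : a ∈ T) : (S \ {a}) \ T = S \ T := by
  rw [sdiff_sdiff_left, sup_eq_right.2 (Finset.singleton_subset_iff.2 ha)]

theorem sdiff_singleton_sdiff_link [Fintype σ] [Std.Refl R] (S : Finset σ) (a : σ) :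
    (S \ {a}) \ link R a = S \ link R a :=
  sdiff_singleton_sdiff S (mem_link.2 (refl_of R a))

/-- The cliques `γ` of `S`, over which the sum defining `μ_S` ranges. -/
def cliques (R : σ → σ → Prop) [DecidableRel R] (S : Finset σ) : Finset (Finset σ) :=
  {γ ∈ S.powerset | ∀ a ∈ γ, ∀ b ∈ γ, a ≠ b → ¬ R a b}

theorem mem_cliques {S γ : Finset σ} :
    γ ∈ cliques R S ↔ γ ⊆ S ∧ (γ : Set σ).Pairwise fun a b => ¬ R a b := by
  simp [cliques, Set.Pairwise]

theorem mobius_eq_sum_powerset {S T : Finset σ} (h : S ⊆ T) :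
    mobius R S = ∑ γ ∈ T.powerset, if γ ∈ cliques R S then (-1) ^ γ.card * X ^ γ.card else 0 := by
  have hcliques : cliques R S ⊆ T.powerset := fun γ hγ =>
    Finset.mem_powerset.2 ((mem_cliques.1 hγ).1.trans h)
  rw [Finset.sum_ite_mem, Finset.inter_eq_right.2 hcliques]
  rfl

section Recursion

variable [Std.Refl R] [Std.Symm R]

theorem insert_mem_cliques_iff [Fintype σ] {S γ : Finset σ} {a : σ} (ha : a ∈ S)
    (hγ : γ ⊆ S \ {a}) : insert a γ ∈ cliques R S ↔ γ ∈ cliques R (S \ link R a) := by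
  have : Std.Symm fun b c => ¬ R b c := ⟨fun b c h h' => h (symm h')⟩
  have haγ : a ∉ (γ : Set σ) := fun h => by simpa using hγ h
  have hS : insert a γ ⊆ S := Finset.insert_subset ha (hγ.trans Finset.sdiff_subset)
  rw [mem_cliques, mem_cliques, ← sdiff_singleton_sdiff_link, Finset.subset_sdiff (u := link R a),
    Finset.coe_insert, Set.pairwise_insert_of_symm_of_notMem haγ, Finset.disjoint_left]
  simp only [hS, hγ, mem_link, Finset.mem_coe]
  tauto

theorem mobius_eq_sub [Fintype σ] {S : Finset σ} {a : σ} (ha : a ∈ S) :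
    mobius R S = mobius R (S \ {a}) - X * mobius R (S \ link R a) := by
  have haS : a ∉ S \ {a} := by simp
  have hS : insert a (S \ {a}) = S := by
    rw [Finset.sdiff_singleton_eq_erase, Finset.insert_erase ha]
  have hlink : S \ link R a ⊆ S \ {a} := by
    rw [← sdiff_singleton_sdiff_link]
    exact Finset.sdiff_subset
  rw [mobius_eq_sum_powerset hlink, mobius_eq_sum_powerset (subset_refl (S \ {a})),
    mobius_eq_sum_powerset hS.ge, Finset.sum_powerset_insert haS, sub_eq_add_neg,
    Finset.mul_sum, ← Finset.sum_neg_distrib]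
  congr 1
  · refine Finset.sum_congr rfl fun γ hγ => if_congr ?_ rfl rfl
    have hγ' := Finset.mem_powerset.1 hγ
    rw [mem_cliques, mem_cliques, iff_true_intro hγ',
      iff_true_intro (hγ'.trans Finset.sdiff_subset)]
  · refine Finset.sum_congr rfl fun γ hγ => ?_
    have hγ' := Finset.mem_powerset.1 hγ
    rw [if_congr (insert_mem_cliques_iff ha hγ') rfl rfl,
      Finset.card_insert_of_notMem fun h => haS (hγ' h)]
    split_ifs
    · ring
    · simp

theorem antitone_mobius_eval [Finite σ] {t : ℝ} (ht : 0 ≤ t)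
    (h : ∀ S : Finset σ, 0 ≤ (mobius R S).eval t) :
    Antitone fun S : Finset σ => (mobius R S).eval t := by
  have := Fintype.ofFinite σ
  refine Finset.antitone_iff_forall_insert_le.2 fun S a ha => ?_
  rw [mobius_eq_sub (Finset.mem_insert_self a S), Finset.sdiff_singleton_eq_erase,
    Finset.erase_insert ha, eval_sub, eval_mul, eval_X]
  exact sub_le_self _ (mul_nonneg ht (h _))

/-- At the first `t ∈ [0, p]` where some `μ_S` vanishes all of them are nonnegative, so by
monotonicity in `S` the polynomial `μ_Σ` would vanish there too. -/
theorem mobius_eval_pos [Fintype σ] {p : ℝ} (h0 : 0 ≤ p)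
    (hp : ENNReal.ofReal p < smallestRoot R Finset.univ) (S : Finset σ) :
    0 < (mobius R S).eval p := by
  by_contra! hS
  obtain ⟨t, ⟨ht0, htp⟩, hnonneg, S₀, hS₀⟩ := exists_forall_nonneg_and_eq_zero h0
    (fun S => (mobius R S).continuousOn) (fun S => by rw [mobius_eval_zero]; exact zero_le_one) hS
  have huniv : (mobius R Finset.univ).eval t = 0 :=
    ((antitone_mobius_eval ht0 hnonneg (Finset.subset_univ S₀)).trans hS₀.le).antisymm (hnonneg _)
  exact mobius_eval_ne_zero_of_lt_smallestRoot ht0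
    ((ENNReal.ofReal_le_ofReal htp).trans_lt hp) huniv

theorem geomParam_eq [Fintype σ] {p : ℝ} {S : Finset σ} {a : σ} (ha : a ∈ S)
    (hne : (mobius R (S \ {a})).eval p ≠ 0) :
    geomParam R S p a =
      p * (mobius R (S \ link R a)).eval p / (mobius R (S \ {a})).eval p := by
  rw [geomParam, mobius_eq_sub ha, eval_sub, eval_mul, eval_X]
  field_simp
  ring

theorem geomParam_pos [Finite σ] {p : ℝ} (hp : 0 < p)
    (hpos : ∀ S : Finset σ, 0 < (mobius R S).eval p)
    {S : Finset σ} {a : σ} (ha : a ∈ S) : 0 < geomParam R S p a := by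
  have := Fintype.ofFinite σ
  rw [geomParam_eq ha (hpos _).ne']
  exact div_pos (mul_pos hp (hpos _)) (hpos _)

end Recursion

theorem geomParam_lt_one {p : ℝ} {S : Finset σ} {a : σ} (hS : 0 < (mobius R S).eval p)
    (hSa : 0 < (mobius R (S \ {a})).eval p) : geomParam R S p a < 1 :=
  sub_lt_self _ (div_pos hS hSa)

end Mobius

section Choices

variable {σ : Type u} [Fintype σ] [DecidableEq σ]

theorem nonempty_choices (R : σ → σ → Prop) [DecidableRel R] (S T : Finset σ) :
    Nonempty (Choices R S T) := by
  induction S using Finset.strongInduction generalizing T with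
  | H S ih =>
    obtain hST | ⟨a, ha⟩ := (S ∩ T).eq_empty_or_nonempty
    · exact ⟨.halt hST⟩
    · have hlt : S \ {a} ⊂ S := by
        rw [Finset.sdiff_singleton_eq_erase]
        exact Finset.erase_ssubset (Finset.mem_inter.1 ha).1
      obtain ⟨V⟩ := ih _ hlt (link R a)
      obtain ⟨U⟩ := ih _ hlt T
      exact ⟨.step a ha (fun _ _ _ => V) fun _ _ => U⟩

end Choices

section Timed

universe v w

variable {α : Type v} {β : Type w}

/-- The law of the result of a timed computation, without its number of steps. -/
def Timed.law (m : Timed α) : PMF α := m.map Prod.fst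

@[simp] theorem Timed.law_ret (a : α) : (Timed.ret a).law = PMF.pure a :=
  PMF.pure_map _ _

@[simp] theorem Timed.law_tick (n : ℕ) (m : Timed α) : (Timed.tick n m).law = m.law := by
  rw [Timed.law, Timed.tick, PMF.map_comp]
  rfl

@[simp] theorem Timed.law_bind (m : Timed α) (f : α → Timed β) :
    (Timed.bind m f).law = m.law.bind fun x => (f x).law := by
  rw [Timed.law, Timed.law, Timed.bind, PMF.map_bind, PMF.bind_map]
  simp only [PMF.map_comp]
  rfl

theorem Timed.mem_support_ret_iff {a x : α} {n : ℕ} :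
    (x, n) ∈ (Timed.ret a).support ↔ x = a ∧ n = 0 := by
  rw [Timed.ret, PMF.mem_support_pure_iff, Prod.mk.injEq]

theorem Timed.mem_support_tick_iff {k n : ℕ} {m : Timed α} {x : α} :
    (x, n) ∈ (Timed.tick k m).support ↔ ∃ j, (x, j) ∈ m.support ∧ k + j = n := by
  simp [Timed.tick]

theorem Timed.mem_support_bind_iff {m : Timed α} {f : α → Timed β} {y : β} {n : ℕ} :
    (y, n) ∈ (Timed.bind m f).support ↔
      ∃ x i j, (x, i) ∈ m.support ∧ (y, j) ∈ (f x).support ∧ i + j = n := by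
  simp [Timed.bind]

end Timed

section Loop

variable {σ : Type u} {R : σ → σ → Prop}

/-- The loop of the algorithm: starting with `ξ = 1`, the `i`-th pass runs `body i ξ`, with
output `v`, and replaces `ξ` by `ξ * v * a`. -/
def loop (c : OpCosts) (a : σ) (body : ℕ → TraceMonoid R → Timed (TraceMonoid R)) (n : ℕ) :
    Timed (TraceMonoid R) :=
  Timed.forLoop (fun i ξ => Timed.bind (body i ξ) fun v =>
    Timed.tick (c.assign + 2 * c.mul + c.assign + c.loop) (Timed.ret (ξ * v * letter R a))) 1 n

theorem law_loop_zero (c : OpCosts) (a : σ)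
    (body : ℕ → TraceMonoid R → Timed (TraceMonoid R)) :
    (loop c a body 0).law = PMF.pure 1 :=
  Timed.law_ret 1

theorem law_loop_succ (c : OpCosts) (a : σ)
    (body : ℕ → TraceMonoid R → Timed (TraceMonoid R)) (n : ℕ) :
    (loop c a body (n + 1)).law =
      (loop c a body n).law.bind fun ξ => (body n ξ).law.map fun v => ξ * v * letter R a := by
  rw [loop, Timed.forLoop, Timed.law_bind, ← loop]
  simp only [Timed.law_bind, Timed.law_tick, Timed.law_ret]
  rfl

theorem law_run_halt [Fintype σ] [DecidableEq σ] [DecidableRel R] (c : OpCosts) (draw : ℕ → ℕ)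
    (p : ℝ) {S T : Finset σ} (h : S ∩ T = ∅) :
    (run c draw p (.halt h : Choices R S T)).law = PMF.pure 1 := by
  rw [run, Timed.law_tick, Timed.law_ret]

theorem law_run_step [Fintype σ] [DecidableEq σ] [DecidableRel R] (c : OpCosts) (draw : ℕ → ℕ)
    (p : ℝ) {S T : Finset σ} {a : σ} (ha : a ∈ S ∩ T)
    (V : ℕ → ℕ → TraceMonoid R → Choices R (S \ {a}) (link R a))
    (U : ℕ → TraceMonoid R → Choices R (S \ {a}) T) :
    (run c draw p (.step a ha V U)).law =
      (geometric (geomParam R S p a)).bind fun K =>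
        (loop c a (fun i ξ => run c draw p (V K i ξ)) K).law.bind fun ξ =>
          (run c draw p (U K ξ)).law.map (ξ * ·) := by
  have hK : Timed.law ((geometric (geomParam R S p a)).map
      fun K => (K, c.call + draw K + c.assign)) = geometric (geomParam R S p a) := by
    rw [Timed.law, PMF.map_comp]
    exact PMF.map_id _
  rw [run]
  simp only [Timed.law_bind, Timed.law_tick, Timed.law_ret, hK]
  rfl

end Loop

section Steps

variable {σ : Type u} {R : σ → σ → Prop}

/-- The number of elementary steps of one call, apart from the passes of its loop, from the draw of
the random integer and from the recursive calls. -/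
def OpCosts.perCall (c : OpCosts) : ℕ :=
  2 * c.call + c.test + c.choose + c.arith + 5 * c.assign + c.loop + c.mul + c.ret

/-- The number of elementary steps of one pass of the loop, apart from the recursive call. -/
def OpCosts.perPass (c : OpCosts) : ℕ :=
  2 * c.assign + 2 * c.mul + c.loop

/-- The constant of the step bound; the summand `1` accounts for the draw of the random integer
`K`, which takes at most one step for each pass of the loop. -/
def OpCosts.total (c : OpCosts) : ℕ :=
  c.perCall + c.perPass + 1

theorem mem_support_loop_succ_iff {c : OpCosts} {a : σ}
    {body : ℕ → TraceMonoid R → Timed (TraceMonoid R)} {k n : ℕ} {x : TraceMonoid R} :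
    (x, n) ∈ (loop c a body (k + 1)).support ↔
      ∃ ξ i v j, (ξ, i) ∈ (loop c a body k).support ∧ (v, j) ∈ (body k ξ).support ∧
        x = ξ * v * letter R a ∧ n = i + j + c.perPass := by
  rw [loop, Timed.forLoop, Timed.mem_support_bind_iff, ← loop]
  simp only [Timed.mem_support_bind_iff, Timed.mem_support_tick_iff, Timed.mem_support_ret_iff,
    OpCosts.perPass]
  constructor
  · rintro ⟨ξ, i, _, hξ, ⟨v, j, _, hv, ⟨_, ⟨rfl, rfl⟩, rfl⟩, rfl⟩, rfl⟩
    exact ⟨ξ, i, v, j, hξ, hv, rfl, by ring⟩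
  · rintro ⟨ξ, i, v, j, hξ, hv, rfl, rfl⟩
    exact ⟨ξ, i, _, hξ, ⟨v, j, _, hv, ⟨0, ⟨rfl, rfl⟩, rfl⟩, rfl⟩, by ring⟩

theorem le_length_of_mem_support_loop {c : OpCosts} {a : σ}
    {body : ℕ → TraceMonoid R → Timed (TraceMonoid R)} {k n : ℕ} {ξ : TraceMonoid R}
    (h : (ξ, n) ∈ (loop c a body k).support) : k ≤ length ξ := by
  induction k generalizing n ξ with
  | zero => exact Nat.zero_le _
  | succ k ih =>
    obtain ⟨ξ, i, v, j, hξ, -, rfl, -⟩ := mem_support_loop_succ_iff.1 h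
    have := ih hξ
    simp only [length_mul, length_letter]
    omega

theorem steps_loop_le {c : OpCosts} {a : σ}
    {body : ℕ → TraceMonoid R → Timed (TraceMonoid R)} {A : ℕ}
    (hbody : ∀ i ξ v n, (v, n) ∈ (body i ξ).support → n ≤ A * (length v + 1))
    {k n : ℕ} {ξ : TraceMonoid R} (h : (ξ, n) ∈ (loop c a body k).support) :
    n ≤ A * length ξ + k * c.perPass := by
  induction k generalizing n ξ with
  | zero =>
    rw [(Timed.mem_support_ret_iff.1 h).2]
    exact Nat.zero_le _
  | succ k ih =>
    obtain ⟨ξ, i, v, j, hξ, hv, rfl, rfl⟩ := mem_support_loop_succ_iff.1 h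
    simp only [length_mul, length_letter]
    calc i + j + c.perPass
        ≤ (A * length ξ + k * c.perPass) + A * (length v + 1) + c.perPass := by
          gcongr
          · exact ih hξ
          · exact hbody k ξ v j hv
      _ = A * (length ξ + length v + 1) + (k + 1) * c.perPass := by ring

variable [Fintype σ] [DecidableEq σ] [DecidableRel R]

theorem exists_of_mem_support_run_step {c : OpCosts} {draw : ℕ → ℕ} {p : ℝ} {S T : Finset σ}
    {a : σ} {ha : a ∈ S ∩ T} {V : ℕ → ℕ → TraceMonoid R → Choices R (S \ {a}) (link R a)}
    {U : ℕ → TraceMonoid R → Choices R (S \ {a}) T} {x : TraceMonoid R} {n : ℕ}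
    (h : (x, n) ∈ (run c draw p (.step a ha V U)).support) :
    ∃ K ξ i u j, (ξ, i) ∈ (loop c a (fun i ξ => run c draw p (V K i ξ)) K).support ∧
      (u, j) ∈ (run c draw p (U K ξ)).support ∧ x = ξ * u ∧ n = c.perCall + draw K + i + j := by
  simp only [run, Timed.mem_support_bind_iff, Timed.mem_support_tick_iff,
    Timed.mem_support_ret_iff, PMF.mem_support_map_iff, Prod.mk.injEq] at h
  obtain ⟨_, ⟨_, _, _, ⟨_, _, rfl, rfl⟩, ⟨_, ⟨ξ, i, _, hξ, ⟨u, j, _, hu, ⟨_, ⟨rfl, rfl⟩, rfl⟩,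
    rfl⟩, rfl⟩, rfl⟩, rfl⟩, rfl⟩ := h
  exact ⟨_, ξ, i, u, j, hξ, hu, rfl, by rw [OpCosts.perCall]; ring⟩

theorem steps_run_le {c : OpCosts} {draw : ℕ → ℕ} (hdraw : ∀ k, draw k ≤ k) {p : ℝ}
    {S T : Finset σ} (d : Choices R S T) {x : TraceMonoid R} {n : ℕ}
    (h : (x, n) ∈ (run c draw p d).support) :
    n ≤ c.total * ((S.card + 1) * (length x + 1)) := by
  induction d generalizing x n with
  | halt h' =>
    rw [run, Timed.mem_support_tick_iff] at h
    obtain ⟨_, h, rfl⟩ := h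
    rw [(Timed.mem_support_ret_iff.1 h).2]
    calc c.call + c.test + c.ret + 0 ≤ c.total := by rw [OpCosts.total, OpCosts.perCall]; omega
      _ ≤ _ := Nat.le_mul_of_pos_right _ (by positivity)
  | @step S T a ha V U ihV ihU =>
    have hcard : (S \ {a}).card + 1 = S.card := by
      rw [Finset.sdiff_singleton_eq_erase]
      exact Finset.card_erase_add_one (Finset.mem_inter.1 ha).1
    rw [hcard] at ihV ihU
    obtain ⟨K, ξ, i, u, j, hξ, hu, rfl, rfl⟩ := exists_of_mem_support_run_step h
    have hi : i ≤ c.total * S.card * length ξ + K * c.perPass :=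
      steps_loop_le (fun i ξ v n hv => (ihV K i ξ hv).trans_eq (mul_assoc _ _ _).symm) hξ
    have hK : K ≤ length (ξ * u) :=
      (le_length_of_mem_support_loop hξ).trans (length_mul ξ u ▸ Nat.le_add_right _ _)
    calc c.perCall + draw K + i + j
        ≤ c.perCall + K + (c.total * S.card * length ξ + K * c.perPass) +
            c.total * (S.card * (length u + 1)) := by
          gcongr
          · exact hdraw K
          · exact ihU K ξ hu
      _ = c.perCall + K * (c.perPass + 1) + c.total * (S.card * (length (ξ * u) + 1)) := by
          rw [length_mul]
          ring
      _ ≤ c.total + length (ξ * u) * c.total + c.total * (S.card * (length (ξ * u) + 1)) := by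
          gcongr <;> rw [OpCosts.total] <;> omega
      _ = c.total * ((S.card + 1) * (length (ξ * u) + 1)) := by ring

end Steps

section Factorization

variable {σ : Type u} {R : σ → σ → Prop}

/-- The traces over `S` whose maximal labels are in `T`. -/
def tracesWithMax (R : σ → σ → Prop) (S T : Finset σ) : Set (TraceMonoid R) :=
  {x | x ∈ subTraces R S ∧ maxLabels x ⊆ T}

theorem tracesWithMax_of_inter_eq_empty [DecidableEq σ] {S T : Finset σ} (h : S ∩ T = ∅) :
    tracesWithMax R S T = {1} := by
  refine Set.Subset.antisymm (fun x hx => eq_one_of_maxLabels_eq_empty ?_)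
    (Set.singleton_subset_iff.2 ⟨one_mem _, by simp [maxLabels_one]⟩)
  have hST := Set.subset_inter (maxLabels_subset_of_mem_subTraces hx.1) hx.2
  rwa [← Finset.coe_inter, h, Finset.coe_empty, Set.subset_empty_iff] at hST

variable [DecidableEq σ]

/-- The traces over `S` with `k` occurrences of `a` and no maximal label other than `a`. These are
the pyramids of apex `a` if `k` is positive, and the unit alone if `k = 0`. -/
def pyramids (R : σ → σ → Prop) (S : Finset σ) (a : σ) (k : ℕ) : Set (TraceMonoid R) :=
  {y | y ∈ subTraces R S ∧ maxLabels y ⊆ {a} ∧ count a y = k}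

theorem pyramids_zero (S : Finset σ) (a : σ) : pyramids R S a 0 = {1} := by
  refine Set.Subset.antisymm ?_
    (Set.singleton_subset_iff.2 ⟨one_mem _, by simp [maxLabels_one], count_one a⟩)
  rintro y ⟨-, hy, h0⟩
  obtain rfl | ⟨z, b, rfl⟩ := eq_one_or_exists_eq_mul_letter y
  · rfl
  · exact (ne_of_count_mul_letter_eq_zero h0 (hy (mem_maxLabels_mul_letter_self z b))).elim

variable [Std.Symm R]

theorem pyramids_succ [Fintype σ] [DecidableRel R] {S : Finset σ} {a : σ} (ha : a ∈ S) (k : ℕ) :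
    pyramids R S a (k + 1) = Set.image2 (fun y v => y * v * letter R a) (pyramids R S a k)
      (tracesWithMax R (S \ {a}) (link R a)) := by
  ext x
  constructor
  · rintro ⟨hxS, hx, hk⟩
    obtain rfl | ⟨z, b, rfl⟩ := eq_one_or_exists_eq_mul_letter x
    · simp at hk
    obtain rfl : b = a := hx (mem_maxLabels_mul_letter_self z b)
    obtain ⟨y, v, rfl, hy, hv⟩ := exists_eq_mul_maxLabels_subset {b} z
    have hv0 : count b v = 0 := hv b rfl
    rw [mul_mem_subTraces_iff, mul_mem_subTraces_iff] at hxS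
    obtain ⟨⟨hyS, hvS⟩, -⟩ := hxS
    have hvS' : v ∈ subTraces R (S \ {b}) := mem_subTraces_sdiff_singleton_iff.2 ⟨hvS, hv0⟩
    refine ⟨y, ⟨hyS, hy, by simpa [hv0] using hk⟩, v, ⟨hvS', fun c hc => ?_⟩, rfl⟩
    have hcb : c ≠ b := by
      simpa using (Finset.mem_sdiff.1 (maxLabels_subset_of_mem_subTraces hvS' hc)).2
    refine mem_link.2 (symm (r := R) (by_contra fun hR => hcb (hx ?_)))
    exact mem_maxLabels_mul_letter_iff.2 (.inr ⟨maxLabels_subset_maxLabels_mul y v hc, hR⟩)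
  · rintro ⟨y, ⟨hyS, hy, hk⟩, v, ⟨hvS, hv⟩, rfl⟩
    rw [mem_subTraces_sdiff_singleton_iff] at hvS
    refine ⟨mul_mem (mul_mem hyS hvS.1) (letter_mem_subTraces_iff.2 ha), fun b hb => ?_,
      by simp [hk, hvS.2]⟩
    obtain rfl | ⟨hb, hR⟩ := mem_maxLabels_mul_letter_iff.1 hb
    · rfl
    · exact (maxLabels_mul_subset y v hb).elim (fun hb => hy hb) fun hb =>
        absurd (symm (mem_link.1 (hv hb))) hR

theorem tracesWithMax_inter_count {S T : Finset σ} {a : σ} (haT : a ∈ T) (k : ℕ) :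
    tracesWithMax R S T ∩ {x | count a x = k} =
      Set.image2 (· * ·) (pyramids R S a k) (tracesWithMax R (S \ {a}) T) := by
  ext x
  constructor
  · rintro ⟨⟨hxS, hx⟩, hk⟩
    obtain ⟨y, u, rfl, hy, hu⟩ := exists_eq_mul_maxLabels_subset {a} x
    have hu0 : count a u = 0 := hu a rfl
    rw [mul_mem_subTraces_iff] at hxS
    exact ⟨y, ⟨hxS.1, hy, by simpa [hu0] using hk⟩, u,
      ⟨mem_subTraces_sdiff_singleton_iff.2 ⟨hxS.2, hu0⟩,
        (maxLabels_subset_maxLabels_mul y u).trans hx⟩, rfl⟩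
  · rintro ⟨y, ⟨hyS, hy, hk⟩, u, ⟨huS, hu⟩, rfl⟩
    rw [mem_subTraces_sdiff_singleton_iff] at huS
    refine ⟨⟨mul_mem hyS huS.1, (maxLabels_mul_subset y u).trans ?_⟩, by simp [hk, huS.2]⟩
    exact Set.union_subset (hy.trans (Set.singleton_subset_iff.2 haT)) hu

theorem injOn_mul_pyramids (S T : Finset σ) (a : σ) (k : ℕ) :
    Set.InjOn (fun z : TraceMonoid R × TraceMonoid R => z.1 * z.2)
      (pyramids R S a k ×ˢ tracesWithMax R (S \ {a}) T) := by
  refine (injOn_mul_maxLabels_subset {a}).mono (Set.prod_mono (fun y hy => hy.2.1) fun v hv => ?_)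
  simpa using (mem_subTraces_sdiff_singleton_iff.1 hv.1).2

theorem injOn_mul_mul_letter_pyramids (S T : Finset σ) (a : σ) (k : ℕ) :
    Set.InjOn (fun z : TraceMonoid R × TraceMonoid R => z.1 * z.2 * letter R a)
      (pyramids R S a k ×ˢ tracesWithMax R (S \ {a}) T) :=
  fun _ hz _ hz' h => injOn_mul_pyramids S T a k hz hz' (mul_letter_right_cancel h)

end Factorization

section Law

theorem bind_map_apply_of_injOn {α β γ : Type*} {m : PMF α} {q : α → PMF β} {g : α → β → γ}
    {P : Set α} {Q : Set β} (hm : m.support ⊆ P) (hq : ∀ y, (q y).support ⊆ Q)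
    (hg : Set.InjOn (fun z : α × β => g z.1 z.2) (P ×ˢ Q)) {y : α} {v : β} (hy : y ∈ P)
    (hv : v ∈ Q) : (m.bind fun y => (q y).map (g y)) (g y v) = m y * q y v := by
  have inj {y' : α} {v' : β} (hy' : y' ∈ P) (hv' : v' ∈ (q y').support)
      (h : g y v = g y' v') : y' = y ∧ v' = v :=
    Prod.mk.inj (hg ⟨hy', hq y' hv'⟩ ⟨hy, hv⟩ h.symm)
  have hmap : (q y).map (g y) (g y v) = q y v := by
    classical
    rw [PMF.map_apply, tsum_eq_single v, if_pos rfl]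
    intro v' hne
    rw [ite_eq_right_iff]
    exact fun h => by_contra fun hv' => hne (inj hy ((PMF.mem_support_iff _ _).2 hv') h).2
  rw [PMF.bind_apply, tsum_eq_single y, hmap]
  intro y' hne
  by_contra h
  obtain ⟨hy', hmem⟩ := ne_zero_and_ne_zero_of_mul h
  obtain ⟨v', hv', h⟩ := (PMF.mem_support_map_iff _ _ _).1 ((PMF.mem_support_iff _ _).2 hmem)
  exact hne (inj (hm ((PMF.mem_support_iff _ _).2 hy')) hv' h.symm).1

variable {σ : Type u} {R : σ → σ → Prop}

/-- The probability distribution `m` on traces is multiplicative on `P`: it gives mass `A * p ^ |x|`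
to each `x ∈ P`, and no mass to the other traces. -/
structure IsMultiplicativeOn (m : PMF (TraceMonoid R)) (P : Set (TraceMonoid R)) (p A : ℝ) :
    Prop where
  apply_of_mem : ∀ x ∈ P, m x = ENNReal.ofReal (A * p ^ length x)
  apply_of_notMem : ∀ x ∉ P, m x = 0

namespace IsMultiplicativeOn

theorem support_subset {m : PMF (TraceMonoid R)} {P : Set (TraceMonoid R)} {p A : ℝ}
    (hm : IsMultiplicativeOn m P p A) : m.support ⊆ P :=
  fun x hx => by_contra fun h => hx (hm.apply_of_notMem x h)

theorem pure_one (p : ℝ) : IsMultiplicativeOn (PMF.pure (1 : TraceMonoid R)) {1} p 1 where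
  apply_of_mem := by
    rintro x rfl
    simp
  apply_of_notMem x hx := PMF.pure_apply_of_ne _ _ hx

theorem bind_map {m : PMF (TraceMonoid R)} {q : TraceMonoid R → PMF (TraceMonoid R)}
    {g : TraceMonoid R → TraceMonoid R → TraceMonoid R} {P Q : Set (TraceMonoid R)}
    {p A B : ℝ} {n : ℕ} (hm : IsMultiplicativeOn m P p A)
    (hq : ∀ y, IsMultiplicativeOn (q y) Q p B) (hp : 0 < p) (hA : 0 ≤ A)
    (hlen : ∀ y v, length (g y v) = length y + length v + n)
    (hg : Set.InjOn (fun z : TraceMonoid R × TraceMonoid R => g z.1 z.2) (P ×ˢ Q)) :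
    IsMultiplicativeOn (m.bind fun y => (q y).map (g y)) (Set.image2 g P Q) p
      (A * B / p ^ n) where
  apply_of_mem := by
    rintro _ ⟨y, hy, v, hv, rfl⟩
    rw [bind_map_apply_of_injOn hm.support_subset (fun y => (hq y).support_subset) hg hy hv,
      hm.apply_of_mem y hy, (hq y).apply_of_mem v hv, ← ENNReal.ofReal_mul (by positivity), hlen,
      pow_add, pow_add]
    congr 1
    field_simp
  apply_of_notMem x hx := by
    rw [PMF.apply_eq_zero_iff]
    refine fun h => hx ?_
    obtain ⟨y, hy, h⟩ := (PMF.mem_support_bind_iff _ _ _).1 h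
    obtain ⟨v, hv, rfl⟩ := (PMF.mem_support_map_iff _ _ _).1 h
    exact ⟨y, hm.support_subset hy, v, (hq y).support_subset hv, rfl⟩

end IsMultiplicativeOn

theorem geometric_apply {r : ℝ} (h0 : 0 ≤ r) (h1 : r < 1) (k : ℕ) :
    geometric r k = ENNReal.ofReal ((1 - r) * r ^ k) :=
  DFunLike.congr_fun (dif_pos (⟨h0, h1⟩ : 0 ≤ r ∧ r < 1)) k

theorem IsMultiplicativeOn.geometric_bind {r : ℝ} (h0 : 0 < r) (h1 : r < 1)
    {q : ℕ → PMF (TraceMonoid R)} {P : Set (TraceMonoid R)} {f : TraceMonoid R → ℕ} {p A : ℝ}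
    (hq : ∀ k, IsMultiplicativeOn (q k) (P ∩ {x | f x = k}) p (A / r ^ k)) :
    IsMultiplicativeOn ((geometric r).bind q) P p ((1 - r) * A) where
  apply_of_mem x hx := by
    have hone : ∀ k ≠ f x, geometric r k * q k x = 0 := fun k hk => by
      rw [(hq k).apply_of_notMem x fun h => hk h.2.symm, mul_zero]
    have hr : 0 < 1 - r := sub_pos.2 h1
    rw [PMF.bind_apply, tsum_eq_single (f x) hone, (hq _).apply_of_mem x ⟨hx, rfl⟩,
      geometric_apply h0.le h1, ← ENNReal.ofReal_mul (by positivity)]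
    congr 1
    field_simp
  apply_of_notMem x hx := by
    rw [PMF.bind_apply, ENNReal.tsum_eq_zero]
    intro k
    rw [(hq k).apply_of_notMem x fun h => hx h.1, mul_zero]

variable [Fintype σ] [DecidableEq σ] [DecidableRel R]

theorem isMultiplicativeOn_loop [Std.Symm R] {p : ℝ} (hp : 0 < p) {B : ℝ} (hB : 0 ≤ B)
    {S : Finset σ} {a : σ} (ha : a ∈ S) (c : OpCosts)
    {body : ℕ → TraceMonoid R → Timed (TraceMonoid R)}
    (hbody : ∀ i ξ,
      IsMultiplicativeOn (body i ξ).law (tracesWithMax R (S \ {a}) (link R a)) p B) (n : ℕ) :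
    IsMultiplicativeOn (loop c a body n).law (pyramids R S a n) p ((B / p) ^ n) := by
  induction n with
  | zero =>
    rw [law_loop_zero, pyramids_zero, pow_zero]
    exact .pure_one p
  | succ n ih =>
    rw [law_loop_succ, pyramids_succ ha]
    convert ih.bind_map (n := 1) (g := fun y v => y * v * letter R a) (hbody n) hp
      (by positivity) (fun y v => by simp) (injOn_mul_mul_letter_pyramids S _ a n) using 1
    rw [pow_succ, pow_one, mul_div_assoc]

variable [Std.Refl R] [Std.Symm R]

theorem isMultiplicativeOn_run {p : ℝ} (hp : 0 < p) (hpos : ∀ S : Finset σ, 0 < (mobius R S).eval p)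
    (c : OpCosts) (draw : ℕ → ℕ) {S T : Finset σ} (d : Choices R S T) :
    IsMultiplicativeOn (run c draw p d).law (tracesWithMax R S T) p
      ((mobius R S).eval p / (mobius R (S \ T)).eval p) := by
  induction d with
  | @halt S T h =>
    rw [law_run_halt, tracesWithMax_of_inter_eq_empty h,
      Finset.sdiff_eq_self_of_disjoint (Finset.disjoint_iff_inter_eq_empty.2 h),
      div_self (hpos S).ne']
    exact .pure_one p
  | @step S T a ha V U ihV ihU =>
    obtain ⟨haS, haT⟩ := Finset.mem_inter.1 ha
    have hr0 := geomParam_pos hp hpos haS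
    have hr1 := geomParam_lt_one (hpos S) (hpos (S \ {a}))
    have hloop (K : ℕ) := isMultiplicativeOn_loop hp (div_pos (hpos _) (hpos _)).le haS c (ihV K) K
    have hratio : (mobius R (S \ {a})).eval p / (mobius R ((S \ {a}) \ link R a)).eval p / p =
        (geomParam R S p a)⁻¹ := by
      rw [geomParam_eq haS (hpos _).ne', sdiff_singleton_sdiff_link, inv_div, div_div, mul_comm p]
    have hconst : (mobius R S).eval p / (mobius R (S \ T)).eval p = (1 - geomParam R S p a) *
        ((mobius R (S \ {a})).eval p / (mobius R ((S \ {a}) \ T)).eval p) := by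
      have := (hpos (S \ {a})).ne'
      rw [sdiff_singleton_sdiff S haT, geomParam, sub_sub_cancel]
      field_simp
    rw [law_run_step, hconst]
    refine .geometric_bind hr0 hr1 (f := count a) fun K => ?_
    rw [tracesWithMax_inter_count haT]
    have hB := (div_pos (hpos (S \ {a})) (hpos ((S \ {a}) \ link R a))).le
    convert (hloop K).bind_map (n := 0) (g := (· * ·)) (ihU K) hp (by positivity)
      (fun y v => by simp) (injOn_mul_pyramids S T a K) using 1
    rw [hratio, inv_pow, pow_zero, div_one, div_eq_inv_mul]

omit [Fintype σ] [Std.Refl R] [Std.Symm R] in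
theorem multProb_singleton (S : Finset σ) (p : ℝ) (x : TraceMonoid R) :
    multProb R S p {x} = (subTraces R S : Set (TraceMonoid R)).indicator
      (fun y => ENNReal.ofReal ((mobius R S).eval p * p ^ length y)) x := by
  classical
  rw [multProb, Measure.sum_apply _ (MeasurableSet.singleton x)]
  simp only [Measure.smul_apply, smul_eq_mul, Measure.dirac_apply]
  refine (tsum_subtype (subTraces R S : Set (TraceMonoid R)) fun y =>
    ENNReal.ofReal ((mobius R S).eval p * p ^ length y) * ({x} : Set _).indicator 1 y).trans ?_
  rw [tsum_eq_single x]
  · simp [Set.indicator_apply]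
  · intro y hy
    simp [Set.indicator_apply, hy]

section Conditioning

variable {p : ℝ} (hp : 0 < p) (hpos : ∀ S : Finset σ, 0 < (mobius R S).eval p) (c : OpCosts)
  (draw : ℕ → ℕ)
include hp hpos

theorem restrict_multProb {S T : Finset σ} (d : Choices R S T) :
    (multProb R S p).restrict {ξ | maxLabels ξ ⊆ (T : Set σ)} =
      ENNReal.ofReal ((mobius R (S \ T)).eval p) • outputLaw c draw p d := by
  have hrun := isMultiplicativeOn_run hp hpos c draw d
  have hST := hpos (S \ T)
  refine Measure.ext_of_singleton fun x => ?_
  rw [Measure.restrict_apply (MeasurableSet.singleton x), Measure.smul_apply, outputLaw,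
    PMF.toMeasure_apply_singleton _ _ (MeasurableSet.singleton x), smul_eq_mul, ← Timed.law]
  by_cases hx : maxLabels x ⊆ T
  · rw [Set.inter_eq_left.2 (Set.singleton_subset_iff.2 hx), multProb_singleton]
    by_cases hxS : x ∈ subTraces R S
    · rw [Set.indicator_of_mem hxS, hrun.apply_of_mem x ⟨hxS, hx⟩, ← ENNReal.ofReal_mul hST.le]
      congr 1
      field_simp
    · rw [Set.indicator_of_notMem hxS, hrun.apply_of_notMem x fun h => hxS h.1, mul_zero]
  · rw [Set.singleton_inter_eq_empty.2 hx, measure_empty,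
      hrun.apply_of_notMem x fun h => hx h.2, mul_zero]

omit [Std.Refl R] [Std.Symm R] hp hpos in
theorem isProbabilityMeasure_outputLaw {S T : Finset σ} (d : Choices R S T) :
    IsProbabilityMeasure (outputLaw c draw p d) := by
  rw [outputLaw]
  infer_instance

theorem outputLaw_eq_cond {S T : Finset σ} (d : Choices R S T) :
    outputLaw c draw p d =
      ProbabilityTheory.cond (multProb R S p) {ξ | maxLabels ξ ⊆ (T : Set σ)} := by
  have := isProbabilityMeasure_outputLaw (p := p) c draw d
  have hrestrict := restrict_multProb hp hpos c draw d
  have hmass : multProb R S p {ξ | maxLabels ξ ⊆ (T : Set σ)} =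
      ENNReal.ofReal ((mobius R (S \ T)).eval p) := by
    simpa using congrArg (· Set.univ) hrestrict
  rw [ProbabilityTheory.cond, hmass, hrestrict, smul_smul,
    ENNReal.inv_mul_cancel (ENNReal.ofReal_ne_zero_iff.2 (hpos _)) ENNReal.ofReal_ne_top, one_smul]

theorem outputLaw_eq_multProb {S : Finset σ} (d : Choices R S Finset.univ) :
    outputLaw c draw p d = multProb R S p := by
  have h := restrict_multProb hp hpos c draw d
  rw [Finset.sdiff_eq_empty_iff_subset.2 (Finset.subset_univ S), mobius_empty] at h
  simpa using h.symm

end Conditioning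

end Law

end TraceSampling

end

theorem theorem1 (c : TraceSampling.OpCosts) :
    ∃ C : ℕ, ∀ (σ : Type u) [Fintype σ] [DecidableEq σ] (R : σ → σ → Prop) [DecidableRel R],
      (∀ a, R a a) → (∀ a b, R a b → R b a) →
      ∀ p : ℝ, 0 < p → ENNReal.ofReal p < TraceSampling.smallestRoot R Finset.univ →
      ∀ draw : ℕ → ℕ, (∀ k, draw k ≤ k) →
        -- every `B_{S,p}` is a probability, and every execution is well defined:
        -- no division by zero, and geometric laws with a parameter in `(0, 1)`
        (∀ S : Finset σ, 0 < (TraceSampling.mobius R S).eval p ∧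
          MeasureTheory.IsProbabilityMeasure (TraceSampling.multProb R S p)) ∧
        (∀ S : Finset σ, ∀ a ∈ S, 0 < TraceSampling.geomParam R S p a ∧
          TraceSampling.geomParam R S p a < 1) ∧
        (∀ S T : Finset σ, Nonempty (TraceSampling.Choices R S T)) ∧
        -- law of the output on input `(Σ, Σ)`, and on input `(S, T)`
        (∀ d : TraceSampling.Choices R Finset.univ Finset.univ,
          TraceSampling.outputLaw c draw p d = TraceSampling.multProb R Finset.univ p) ∧
        (∀ (S T : Finset σ) (d : TraceSampling.Choices R S T),
          TraceSampling.outputLaw c draw p d =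
            ProbabilityTheory.cond (TraceSampling.multProb R S p)
              {ξ | TraceSampling.maxLabels ξ ⊆ (T : Set σ)}) ∧
        -- number of steps on input `(Σ, Σ)`, and on input `(S, T)`
        (Nonempty σ → ∀ d : TraceSampling.Choices R Finset.univ Finset.univ,
          ∀ e ∈ (TraceSampling.run c draw p d).support,
            e.2 ≤ C * (Fintype.card σ * (TraceSampling.length e.1 + 1))) ∧
        (∀ (S T : Finset σ) (d : TraceSampling.Choices R S T),
          ∀ e ∈ (TraceSampling.run c draw p d).support,
            e.2 ≤ C * ((S.card + 1) * (TraceSampling.length e.1 + 1))) :=  by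
  refine ⟨2 * c.total, fun σ _ _ R _ hr hs p hp hroot draw hdraw => ?_⟩
  have : Std.Refl R := ⟨hr⟩
  have : Std.Symm R := ⟨hs⟩
  have hpos := TraceSampling.mobius_eval_pos hp.le hroot
  refine ⟨fun S => ⟨hpos S, ?_⟩,
    fun S a ha => ⟨TraceSampling.geomParam_pos hp hpos ha,
      TraceSampling.geomParam_lt_one (hpos _) (hpos _)⟩,
    TraceSampling.nonempty_choices R,
    fun d => TraceSampling.outputLaw_eq_multProb hp hpos c draw d,
    fun S T d => TraceSampling.outputLaw_eq_cond hp hpos c draw d,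
    fun _ d e he => ?_, fun S T d e he => ?_⟩
  · obtain ⟨d⟩ := TraceSampling.nonempty_choices R S Finset.univ
    exact TraceSampling.outputLaw_eq_multProb hp hpos c draw d ▸
      TraceSampling.isProbabilityMeasure_outputLaw c draw d
  · calc e.2 ≤ c.total * ((Fintype.card σ + 1) * (TraceSampling.length e.1 + 1)) :=
          TraceSampling.steps_run_le hdraw d he
      _ ≤ c.total * ((2 * Fintype.card σ) * (TraceSampling.length e.1 + 1)) := by
          gcongr
          linarith [Fintype.card_pos (α := σ)]
      _ = 2 * c.total * (Fintype.card σ * (TraceSampling.length e.1 + 1)) := by ring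
  · refine (TraceSampling.steps_run_le hdraw d he).trans ?_
    gcongr
    exact Nat.le_mul_of_pos_left _ two_pos
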